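/- Let $X$ be a real locally convex topological vector space with topological dual $X^*$, and let $f,g\colon X\to(-\infty,\infty]$ be proper convex functions (proper: $\operatorname{dom} f:=\{x\in X : f(x)<\infty\}\neq\emptyset$, and likewise for $g$). Suppose that $f$ is polyhedral, i.e. its epigraph $\{(x,\lambda)\in X\times\mathbb{R} : f(x)\le\lambda\}$ is the intersection of finitely many closed half-spaces $\{z\in X\times\mathbb{R} : \langle z_i^*,z\rangle\le\alpha_i\}$ with $z_i^*\in (X\times\mathbb{R})^*$ and $\alpha_i\in\mathbb{R}$. For a set $\Omega\subset X$ write $$\operatorname{qri}(\Omega):=\big\{x\in\Omega : \overline{\operatorname{cone}(\Omega-x)}\ \text{is a linear subspace of } X\big\},\qquad \operatorname{cone}(A):=\{ta : t\ge 0,\ a\in A\},$$ and assume that $$\operatorname{dom} f\cap\operatorname{qri}(\operatorname{dom} g)\neq\emptyset .$$ For a proper function $h\colon X\to(-\infty,\infty]$ let $h^*(x^*):=\sup\{\langle x^*,x\rangle-h(x) : x\in X\}$ for $x^*\in X^*$ be its Fenchel conjugate, and let $(f^*\mathbin{\square}g^*)(x^*):=\inf\{f^*(x_1^*)+g^*(x_2^*)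 : x_1^*,x_2^*\in X^*,\ x_1^*+x_2^*=x^*\}$ denote the infimal convolution. Then $$(f+g)^*(x^*)=(f^*\mathbin{\square}g^*)(x^*)\qquad\text{for all } x^*\in X^*.$$ Moreover, the infimum is attained whenever $(f+g)^*(x^*)<\infty$: for every such $x^*\in X^*$ there exist $x_1^*,x_2^*\in X^*$ with $x^*=x_1^*+x_2^*$ and $$(f+g)^*(x^*)=f^*(x_1^*)+g^*(x_2^*).$$ -/

import Mathlib

namespace PolyConvex

/-- The conic hull `cone A = {t a | t ≥ 0, a ∈ A}`. -/
def conicHull {X : Type*} [AddCommGroup X] [Module ℝ X] (A : Set X) : Set X :=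
  {y | ∃ t : ℝ, 0 ≤ t ∧ ∃ a ∈ A, y = t • a}

/-- The quasi-relative interior of `Ω`: the points `x ∈ Ω` such that the closure of
`cone (Ω - x)` is a linear subspace. -/
def qri {X : Type*} [AddCommGroup X] [Module ℝ X] [TopologicalSpace X] (Ω : Set X) : Set X :=
  {x | x ∈ Ω ∧ ∃ S : Submodule ℝ X, (S : Set X) = closure (conicHull ((fun y => y - x) '' Ω))}

/-- A convex polyhedron: a finite intersection of closed half-spaces given by continuous linear
functionals. -/
def IsPolyhedral {X : Type*} [AddCommGroup X] [Module ℝ X] [TopologicalSpace X]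
    (P : Set X) : Prop :=
  ∃ (k : ℕ) (φ : Fin k → StrongDual ℝ X) (α : Fin k → ℝ), P = {x | ∀ i, φ i x ≤ α i}

/-- The effective domain of an extended-real-valued function. -/
def effDom {X : Type*} (f : X → EReal) : Set X := {x | f x < ⊤}

/-- The epigraph of an extended-real-valued function, a subset of `X × ℝ`. -/
def epi {X : Type*} (f : X → EReal) : Set (X × ℝ) := {p | f p.1 ≤ (p.2 : EReal)}

/-- `f` is proper: it takes values in `(-∞, ∞]` and its effective domain is nonempty. -/
def IsProper {X : Type*} (f : X → EReal) : Prop :=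
  (∀ x, f x ≠ ⊥) ∧ (effDom f).Nonempty

/-- `f` is convex: its epigraph is a convex set. -/
def IsConvexFun {X : Type*} [AddCommGroup X] [Module ℝ X] (f : X → EReal) : Prop :=
  Convex ℝ (epi f)

/-- `f` is polyhedral: its epigraph is a convex polyhedron in `X × ℝ`. -/
def IsPolyhedralFun {X : Type*} [AddCommGroup X] [Module ℝ X] [TopologicalSpace X]
    (f : X → EReal) : Prop :=
  IsPolyhedral (epi f)

/-- The Fenchel conjugate `f*(x*) = sup {⟨x*, x⟩ - f x | x ∈ X}`, a function on the topological
dual. -/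
noncomputable def conj {X : Type*} [AddCommGroup X] [Module ℝ X] [TopologicalSpace X]
    (f : X → EReal) (x' : StrongDual ℝ X) : EReal :=
  ⨆ x : X, ((x' x : ℝ) : EReal) - f x

/-- The infimal convolution `(φ □ ψ)(x) = inf {φ u + ψ v | u + v = x}`. It is used only for
functions that never take the value `-∞`, so that no sum `∞ - ∞` occurs. -/
noncomputable def infConv {E : Type*} [AddCommGroup E] (φ ψ : E → EReal) (x : E) : EReal :=
  ⨅ (u : E) (v : E) (_ : u + v = x), φ u + ψ v

end PolyConvex

/-!
The proof turns the duality statement into Lagrange duality for a convex program with finitely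
many affine constraints. Put `Y = X × ℝ`, `C = dom g × ℝ` and `h (x, l) = g x + l - x' x`. That
`(f + g)* x' ≤ M` says precisely that `-M ≤ h` on `C ∩ epi f`, and `epi f` is cut out by finitely
many inequalities. A Lagrange multiplier is a continuous functional `b` with `b ≤ β` on
`epi f` and `-M ≤ h + (b - β)` on all of `C`. As `l` is free in `C`, the functional has the form
`b (x, l) = u x - l`, and the two inequalities read `f* u ≤ β` and `g* (x' - u) ≤ M - β`.
Together with the Fenchel-Young inequality this gives the formula and the attainment.

Multipliers exist (`exists_multiplier`) by induction on the number of constraints. The point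
`x₀` provided by the hypothesis on the quasi-relative interior is used only through its dual
property `IsDualQri`: a continuous functional minimized over `C` at `x₀` is constant on `C`. This
property survives moving `x₀` towards another point of `C`, and cutting `C` by `a ≤ α` if
`a x₀ < α` or by `a = α` if `a x₀ = α`. To add a constraint `a ≤ α` to those already treated,
there are two cases.
* If some point of `C` satisfies the old constraints and `a < α`, then, moving `x₀` towards that
  point, it may be assumed that `a x₀ < α`. The induction hypothesis applies to
  `C ∩ {a ≤ α}`, and a Slater argument in one dimension supplies the multiplier of `a`.
* Otherwise `a ≥ α` under the old constraints, so the induction hypothesis applied to the objective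
  `a` gives `p ≤ π` valid under these constraints with `a + p ≥ α + π` on `C`. Equality
  holds at `x₀`, hence on all of `C`. The induction hypothesis on `C ∩ {a = α}` gives a multiplier
  in which `a` enters with a coefficient of unknown sign; a negative coefficient is removed by
  replacing `a - α` by `π - p`.
-/

namespace PolyConvex

/-! ### Lagrange multipliers for affine constraints -/

section Multiplier

variable {Y : Type*} [AddCommGroup Y] [Module ℝ Y] [TopologicalSpace Y]

/-- The dual form of membership in the quasi-relative interior: `x₀ ∈ C`, and every continuous
linear functional which attains its minimum over `C` at `x₀` is constant on `C`. -/
def IsDualQri (C : Set Y) (x₀ : Y) : Prop :=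
  x₀ ∈ C ∧ ∀ b : StrongDual ℝ Y, (∀ x ∈ C, b x₀ ≤ b x) → ∀ x ∈ C, b x = b x₀

/-- A multiplier of unrestricted sign for one equality constraint, when `C` has points on both
sides of the hyperplane. -/
theorem exists_equality_multiplier {C : Set Y} {h : Y → ℝ} (hC : ConvexOn ℝ C h)
    (a : StrongDual ℝ Y) {α m : ℝ} (hm : ∀ x ∈ C, a x = α → m ≤ h x)
    (hpos : ∃ x ∈ C, α < a x) (hneg : ∃ x ∈ C, a x < α) :
    ∃ t : ℝ, ∀ x ∈ C, m ≤ h x + t * (a x - α) := by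
  -- Any `t` between the slopes forced by the points above and by those below the hyperplane works.
  obtain ⟨t, ht₁, ht₂⟩ := exists_between_of_forall_le
    (s := (fun x => (m - h x) / (a x - α)) '' {x | x ∈ C ∧ α < a x})
    (t := (fun x => (h x - m) / (α - a x)) '' {x | x ∈ C ∧ a x < α})
    (by obtain ⟨x, hx, h'⟩ := hpos; exact ⟨_, x, ⟨hx, h'⟩, rfl⟩)
    (by obtain ⟨x, hx, h'⟩ := hneg; exact ⟨_, x, ⟨hx, h'⟩, rfl⟩) (by
      rintro _ ⟨x, ⟨hx, hxa⟩, rfl⟩ _ ⟨y, ⟨hy, hya⟩, rfl⟩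
      have h1 : 0 < a x - α := by linarith
      have h2 : 0 < α - a y := by linarith
      have hd : 0 < a x - a y := by linarith
      -- The segment from `x` to `y` crosses the hyperplane at the point with these weights.
      have hsum : (α - a y) / (a x - a y) + (a x - α) / (a x - a y) = 1 := by
        field_simp
        ring
      have hw1 : 0 ≤ (α - a y) / (a x - a y) := by positivity
      have hw2 : 0 ≤ (a x - α) / (a x - a y) := by positivity
      have hmem := hC.1 hx hy hw1 hw2 hsum
      have hval := hC.2 hx hy hw1 hw2 hsum
      have hcross := hm _ hmem (by
        simp only [map_add, map_smul, smul_eq_mul]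
        field_simp
        ring)
      have hle := hcross.trans hval
      simp only [smul_eq_mul] at hle
      have hle' : m * (a x - a y) ≤ (α - a y) * h x + (a x - α) * h y := by
        have := mul_le_mul_of_nonneg_right hle hd.le
        calc _ ≤ _ := this
          _ = _ := by field_simp
      change (m - h x) / (a x - α) ≤ (h y - m) / (α - a y)
      rw [div_le_div_iff₀ h1 h2]
      nlinarith)
  refine ⟨t, fun x hx => ?_⟩
  rcases lt_trichotomy (a x) α with hxa | hxa | hxa
  · have := ht₂ ⟨x, ⟨hx, hxa⟩, rfl⟩
    rw [le_div_iff₀ (by linarith)] at this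
    linarith
  · have := hm x hx hxa
    simpa [hxa] using this
  · have := ht₁ ⟨x, ⟨hx, hxa⟩, rfl⟩
    rw [div_le_iff₀ (by linarith)] at this
    linarith

/-- A nonnegative multiplier for one inequality constraint under the Slater condition. -/
theorem exists_nonneg_multiplier {C : Set Y} {h : Y → ℝ} (hC : ConvexOn ℝ C h)
    (a : StrongDual ℝ Y) {α m : ℝ} (hm : ∀ x ∈ C, a x ≤ α → m ≤ h x)
    (hneg : ∃ x ∈ C, a x < α) :
    ∃ t : ℝ, 0 ≤ t ∧ ∀ x ∈ C, m ≤ h x + t * (a x - α) := by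
  by_cases hpos : ∃ x ∈ C, α < a x
  · obtain ⟨t, ht⟩ := exists_equality_multiplier hC a (fun x hx hxa => hm x hx hxa.le) hpos hneg
    rcases le_total 0 t with h0 | h0
    · exact ⟨t, h0, ht⟩
    · refine ⟨0, le_rfl, fun x hx => ?_⟩
      rcases le_or_gt (a x) α with hxa | hxa
      · simpa using hm x hx hxa
      · have := ht x hx
        nlinarith
  · push Not at hpos
    exact ⟨0, le_rfl, fun x hx => by simpa using hm x hx (hpos x hx)⟩

theorem convexOn_strongDual {C : Set Y} (hC : Convex ℝ C) (a : StrongDual ℝ Y) :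
    ConvexOn ℝ C a :=
  a.toLinearMap.convexOn hC

theorem convex_inter_le {C : Set Y} (hC : Convex ℝ C) (a : StrongDual ℝ Y) (α : ℝ) :
    Convex ℝ (C ∩ {x | a x ≤ α}) :=
  hC.inter (convex_halfSpace_le a.toLinearMap.isLinear α)

theorem convex_inter_eq {C : Set Y} (hC : Convex ℝ C) (a : StrongDual ℝ Y) (α : ℝ) :
    Convex ℝ (C ∩ {x | a x = α}) :=
  hC.inter (convex_hyperplane a.toLinearMap.isLinear α)

/-- A multiplier of unrestricted sign for an equality constraint through a point of the
quasi-relative interior. -/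
theorem IsDualQri.exists_equality_multiplier {C : Set Y} {x₀ : Y} (hx₀ : IsDualQri C x₀)
    {h : Y → ℝ} (hC : ConvexOn ℝ C h) (a : StrongDual ℝ Y) {m : ℝ}
    (hm : ∀ x ∈ C, a x = a x₀ → m ≤ h x) :
    ∃ t : ℝ, ∀ x ∈ C, m ≤ h x + t * (a x - a x₀) := by
  by_cases hconst : ∀ x ∈ C, a x = a x₀
  · exact ⟨0, fun x hx => by simpa using hm x hx (hconst x hx)⟩
  · refine PolyConvex.exists_equality_multiplier hC a hm ?_ ?_
    · by_contra! hle
      refine hconst fun x hx => ?_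
      have := hx₀.2 (-a) (fun y hy => by simpa using hle y hy) x hx
      simpa using this
    · by_contra! hle
      exact hconst (hx₀.2 a hle)

theorem IsDualQri.inter_eq {C : Set Y} {x₀ : Y} (hx₀ : IsDualQri C x₀) (hC : Convex ℝ C)
    (a : StrongDual ℝ Y) : IsDualQri (C ∩ {x | a x = a x₀}) x₀ := by
  refine ⟨⟨hx₀.1, rfl⟩, fun b hb x hx => ?_⟩
  -- A multiple of `a` added to `b` makes `x₀` a minimizer over all of `C`.
  obtain ⟨t, ht⟩ := hx₀.exists_equality_multiplier (convexOn_strongDual hC b) a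
    (fun y hy hya => hb y ⟨hy, hya⟩)
  have := hx₀.2 (b + t • a) (fun y hy => by
    have := ht y hy
    simp
    linarith) x hx.1
  have hxa : a x = a x₀ := hx.2
  simpa [hxa] using this

theorem IsDualQri.inter_le {C : Set Y} {x₀ : Y} (hx₀ : IsDualQri C x₀) (hC : Convex ℝ C)
    (a : StrongDual ℝ Y) {α : ℝ} (ha : a x₀ < α) : IsDualQri (C ∩ {x | a x ≤ α}) x₀ := by
  refine ⟨⟨hx₀.1, ha.le⟩, fun b hb x hx => hx₀.2 b (fun y hy => ?_) x hx.1⟩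
  obtain ⟨t, h0, ht⟩ := exists_nonneg_multiplier (convexOn_strongDual hC b) a
    (fun y hy hya => hb y ⟨hy, hya⟩) ⟨x₀, hx₀.1, ha⟩
  -- Complementary slackness at `x₀`, where the constraint is inactive, forces `t = 0`.
  have h1 := ht x₀ hx₀.1
  have ht0 : t = 0 := by nlinarith
  simpa [ht0] using ht y hy

theorem IsDualQri.midpoint {C : Set Y} {x₀ z : Y} (hx₀ : IsDualQri C x₀) (hC : Convex ℝ C)
    (hz : z ∈ C) : IsDualQri C ((1 / 2 : ℝ) • x₀ + (1 / 2 : ℝ) • z) := by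
  refine ⟨hC hx₀.1 hz (by norm_num) (by norm_num) (by norm_num), fun b hb => ?_⟩
  have h1 := hb x₀ hx₀.1
  have h2 := hb z hz
  simp only [map_add, map_smul, smul_eq_mul] at h1 h2 hb ⊢
  have hbz : b z = b x₀ := hx₀.2 b (fun x hx => by linarith [hb x hx]) z hz
  intro x hx
  rw [hx₀.2 b (fun x hx => by linarith [hb x hx]) x hx, hbz]
  ring

/-- Lagrange duality for a convex objective under finitely many affine constraints which are
satisfied at a point of the quasi-relative interior of the domain. The nonnegative combination
of the constraints is recorded as one inequality `b ≤ β` valid on the whole polyhedron. -/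
theorem exists_multiplier {ι : Type*} (φ : ι → StrongDual ℝ Y) (α : ι → ℝ) (s : Finset ι) :
    ∀ (C : Set Y) (h : Y → ℝ) (m : ℝ) (x₀ : Y), ConvexOn ℝ C h → IsDualQri C x₀ →
      (∀ i ∈ s, φ i x₀ ≤ α i) → (∀ x ∈ C, (∀ i ∈ s, φ i x ≤ α i) → m ≤ h x) →
      ∃ (b : StrongDual ℝ Y) (β : ℝ), (∀ y, (∀ i ∈ s, φ i y ≤ α i) → b y ≤ β) ∧
        ∀ x ∈ C, m ≤ h x + (b x - β) := by
  classical
  induction s using Finset.induction_on with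
  | empty =>
    intro C h m x₀ _ _ _ hm
    exact ⟨0, 0, by simp, fun x hx => by simpa using hm x hx (by simp)⟩
  | insert k s _ ih =>
    intro C h m x₀ hC hx₀ hfeas hm
    simp only [Finset.forall_mem_insert] at hfeas hm ⊢
    by_cases hslater : ∃ z ∈ C, (∀ i ∈ s, φ i z ≤ α i) ∧ φ k z < α k
    · obtain ⟨z, hz, hzs, hzk⟩ := hslater
      have hx₁ := hx₀.midpoint hC.1 hz
      set x₁ := (1 / 2 : ℝ) • x₀ + (1 / 2 : ℝ) • z with hx₁_def
      have hval : ∀ i, φ i x₁ = 1 / 2 * φ i x₀ + 1 / 2 * φ i z := fun i => by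
        simp [hx₁_def]
      have hx₁k : φ k x₁ < α k := by
        rw [hval]
        linarith [hfeas.1]
      obtain ⟨b, β, hb, hbm⟩ := ih (C ∩ {x | φ k x ≤ α k}) h m x₁
        (hC.subset Set.inter_subset_left (convex_inter_le hC.1 _ _))
        (hx₁.inter_le hC.1 _ hx₁k)
        (fun i hi => by rw [hval]; linarith [hfeas.2 i hi, hzs i hi])
        (fun x hx hxs => hm x hx.1 ⟨hx.2, hxs⟩)
      obtain ⟨t, ht0, ht⟩ := exists_nonneg_multiplier
        (hC.add ((convexOn_strongDual hC.1 b).add_const (-β))) (φ k)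
        (fun x hx hxk => by simpa [sub_eq_add_neg] using hbm x ⟨hx, hxk⟩) ⟨x₁, hx₁.1, hx₁k⟩
      refine ⟨b + t • φ k, β + t * α k, fun y hy => ?_, fun x hx => ?_⟩
      · have := mul_le_mul_of_nonneg_left hy.1 ht0
        simpa using add_le_add (hb y hy.2) this
      · have := ht x hx
        simp at this ⊢
        linarith
    · push Not at hslater
      have hk : φ k x₀ = α k := le_antisymm hfeas.1 (hslater x₀ hx₀.1 hfeas.2)
      obtain ⟨p, π, hp, hpm⟩ := ih C (φ k) (α k) x₀ (convexOn_strongDual hC.1 _) hx₀ hfeas.2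
        hslater
      have hp₀ : p x₀ = π := by
        linarith [hp x₀ hfeas.2, hpm x₀ hx₀.1]
      have hconst : ∀ x ∈ C, φ k x + p x = α k + π := fun x hx => by
        have := hx₀.2 (φ k + p) (fun y hy => by
          have := hpm y hy
          simp only [add_apply]
          linarith) x hx
        simpa [hk, hp₀] using this
      obtain ⟨q, κ, hq, hqm⟩ := ih (C ∩ {x | φ k x = φ k x₀}) h m x₀
        (hC.subset Set.inter_subset_left (convex_inter_eq hC.1 _ _)) (hx₀.inter_eq hC.1 _)
        hfeas.2 (fun x hx hxs => hm x hx.1 ⟨(hx.2.trans hk).le, hxs⟩)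
      obtain ⟨t, ht⟩ := hx₀.exists_equality_multiplier
        (hC.add ((convexOn_strongDual hC.1 q).add_const (-κ))) (φ k)
        (fun x hx hxk => by simpa [sub_eq_add_neg] using hqm x ⟨hx, hxk⟩)
      rw [hk] at ht
      rcases le_total 0 t with ht0 | ht0
      · refine ⟨q + t • φ k, κ + t * α k, fun y hy => ?_, fun x hx => ?_⟩
        · have := mul_le_mul_of_nonneg_left hy.1 ht0
          simpa using add_le_add (hq y hy.2) this
        · have := ht x hx
          simp at this ⊢
          linarith
      · -- On `C` the term `t * (φ k - α k)` equals `(-t) * (p - π)`, and here `-t` is nonnegative.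
        refine ⟨q + (-t) • p, κ + (-t) * π, fun y hy => ?_, fun x hx => ?_⟩
        · have := mul_le_mul_of_nonneg_left (hp y hy.2) (neg_nonneg.2 ht0)
          simpa using add_le_add (hq y hy.2) this
        · have h1 := ht x hx
          have h2 : φ k x = α k + π - p x := by linarith [hconst x hx]
          rw [h2] at h1
          simp at h1 ⊢
          linarith

end Multiplier

/-! ### Quasi-relative interior and effective domains -/

section Domain

variable {X : Type*} [AddCommGroup X] [Module ℝ X]

theorem isDualQri_of_mem_qri [TopologicalSpace X] {Ω : Set X} {x₀ : X} (hx₀ : x₀ ∈ qri Ω) :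
    IsDualQri Ω x₀ := by
  obtain ⟨hmem, S, hS⟩ := hx₀
  refine ⟨hmem, fun b hb x hx => ?_⟩
  have hnonneg : ∀ y ∈ S, 0 ≤ b y := by
    have hsub : closure (conicHull ((fun y => y - x₀) '' Ω)) ⊆ {y | 0 ≤ b y} := by
      refine closure_minimal ?_ (isClosed_Ici.preimage b.continuous)
      rintro _ ⟨t, ht, _, ⟨y, hy, rfl⟩, rfl⟩
      have := mul_nonneg ht (sub_nonneg.2 (hb y hy))
      simpa using this
    intro y hy
    have hy' : y ∈ (S : Set X) := hy
    rw [hS] at hy'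
    exact hsub hy'
  have hxS : x - x₀ ∈ S := by
    change x - x₀ ∈ (S : Set X)
    rw [hS]
    exact subset_closure ⟨1, zero_le_one, _, ⟨x, hx, rfl⟩, by simp⟩
  have h1 := hnonneg _ hxS
  have h2 := hnonneg _ (S.neg_mem hxS)
  simp only [map_neg, map_sub] at h1 h2
  linarith

theorem IsDualQri.prod_univ [TopologicalSpace X] {Ω : Set X} {x₀ : X} (hx₀ : IsDualQri Ω x₀)
    (l₀ : ℝ) : IsDualQri (Ω ×ˢ (Set.univ : Set ℝ)) (x₀, l₀) := by
  refine ⟨⟨hx₀.1, trivial⟩, fun b hb => ?_⟩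
  have hdec : ∀ x l, b (x, l) = b (x, 0) + l * b (0, 1) := fun x l => by
    have : ((x, l) : X × ℝ) = (x, 0) + l • (0, 1) := by simp
    rw [this, map_add, map_smul, smul_eq_mul]
  have hle : ∀ x ∈ Ω, ∀ l, b (x₀, l₀) ≤ b (x, l) := fun x hx l => hb (x, l) ⟨hx, trivial⟩
  have h0 : b (0, 1) = 0 := by
    have h1 := hle x₀ hx₀.1 (l₀ + 1)
    have h2 := hle x₀ hx₀.1 (l₀ - 1)
    rw [hdec, hdec x₀ (l₀ + 1)] at h1
    rw [hdec, hdec x₀ (l₀ - 1)] at h2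
    linarith
  have hred : ∀ x l, b (x, l) = (b.comp (ContinuousLinearMap.inl ℝ X ℝ)) x := fun x l => by
    rw [hdec, h0]
    simp
  rintro ⟨x, l⟩ ⟨hx, -⟩
  rw [hred, hred]
  refine hx₀.2 _ (fun y hy => ?_) x hx
  have := hle y hy l₀
  rwa [hred, hred] at this

theorem coe_toReal_of_mem_effDom {Z : Type*} {g : Z → EReal} (hg : ∀ x, g x ≠ ⊥) {x : Z}
    (hx : x ∈ effDom g) : ((g x).toReal : EReal) = g x :=
  EReal.coe_toReal (ne_of_lt hx) (hg x)

theorem IsConvexFun.convexOn_toReal {g : X → EReal} (hgc : IsConvexFun g) (hg : ∀ x, g x ≠ ⊥) :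
    ConvexOn ℝ (effDom g) fun x => (g x).toReal := by
  have key : ∀ ⦃x⦄, x ∈ effDom g → ∀ ⦃y⦄, y ∈ effDom g → ∀ ⦃a b : ℝ⦄, 0 ≤ a → 0 ≤ b → a + b = 1 →
      g (a • x + b • y) ≤ ((a * (g x).toReal + b * (g y).toReal : ℝ) : EReal) := by
    intro x hx y hy a b ha hb hab
    have hx' : (x, (g x).toReal) ∈ epi g := (coe_toReal_of_mem_effDom hg hx).ge
    have hy' : (y, (g y).toReal) ∈ epi g := (coe_toReal_of_mem_effDom hg hy).ge
    exact hgc hx' hy' ha hb hab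
  refine ⟨fun x hx y hy a b ha hb hab => ?_, fun x hx y hy a b ha hb hab => ?_⟩
  · exact (key hx hy ha hb hab).trans_lt (EReal.coe_lt_top _)
  · have hle := key hx hy ha hb hab
    have hmem : a • x + b • y ∈ effDom g := hle.trans_lt (EReal.coe_lt_top _)
    rw [← coe_toReal_of_mem_effDom hg hmem] at hle
    exact EReal.coe_le_coe_iff.1 hle

end Domain

/-! ### Fenchel conjugates -/

section Conjugate

variable {X : Type*} [AddCommGroup X] [Module ℝ X] [TopologicalSpace X]

/-- An upper bound for the conjugate only has to be checked on the effective domain. -/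
theorem conj_le_coe_iff {f : X → EReal} (hf : ∀ x, f x ≠ ⊥) (u : StrongDual ℝ X) (β : ℝ) :
    conj f u ≤ (β : EReal) ↔ ∀ x ∈ effDom f, u x - (f x).toReal ≤ β := by
  rw [conj, iSup_le_iff]
  refine forall_congr' fun x => ?_
  by_cases hx : x ∈ effDom f
  · rw [← coe_toReal_of_mem_effDom hf hx, ← EReal.coe_sub, EReal.coe_le_coe_iff]
    simp [hx]
  · have : f x = ⊤ := not_lt_top_iff.1 hx
    simp [hx, this]

theorem bot_lt_conj {f : X → EReal} (hf : IsProper f) (u : StrongDual ℝ X) : ⊥ < conj f u := by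
  obtain ⟨x, hx⟩ := hf.2
  refine lt_of_lt_of_le ?_ (le_iSup _ x)
  rw [← coe_toReal_of_mem_effDom hf.1 hx, ← EReal.coe_sub]
  exact EReal.bot_lt_coe _

theorem mem_effDom_add {Z : Type*} {f g : Z → EReal} (hf : ∀ x, f x ≠ ⊥) (hg : ∀ x, g x ≠ ⊥)
    {x : Z} : x ∈ effDom (f + g) ↔ x ∈ effDom f ∧ x ∈ effDom g := by
  simp only [effDom, Set.mem_ofPred_eq, Pi.add_apply, lt_top_iff_ne_top]
  exact EReal.add_ne_top_iff_ne_top₂ (hf x) (hg x)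

theorem toReal_add_apply {Z : Type*} {f g : Z → EReal} (hf : ∀ x, f x ≠ ⊥) (hg : ∀ x, g x ≠ ⊥)
    {x : Z} (hxf : x ∈ effDom f) (hxg : x ∈ effDom g) :
    ((f + g) x).toReal = (f x).toReal + (g x).toReal :=
  EReal.toReal_add (ne_of_lt hxf) (hf x) (ne_of_lt hxg) (hg x)

theorem add_apply_ne_bot {Z : Type*} {f g : Z → EReal} (hf : ∀ x, f x ≠ ⊥) (hg : ∀ x, g x ≠ ⊥)
    (x : Z) : (f + g) x ≠ ⊥ := by
  simp [EReal.add_eq_bot_iff, hf x, hg x]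

theorem conj_add_le {f g : X → EReal} (hf : IsProper f) (hg : IsProper g)
    (u v : StrongDual ℝ X) : conj (f + g) (u + v) ≤ conj f u + conj g v := by
  by_cases hu : conj f u = ⊤
  · simp [hu, EReal.top_add_of_ne_bot (bot_lt_conj hg v).ne']
  by_cases hv : conj g v = ⊤
  · simp [hv, EReal.add_top_of_ne_bot (bot_lt_conj hf u).ne']
  have hcu := EReal.coe_toReal hu (bot_lt_conj hf u).ne'
  have hcv := EReal.coe_toReal hv (bot_lt_conj hg v).ne'
  rw [← hcu, ← hcv, ← EReal.coe_add,
    conj_le_coe_iff (add_apply_ne_bot hf.1 hg.1)]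
  intro x hx
  obtain ⟨hxf, hxg⟩ := (mem_effDom_add hf.1 hg.1).1 hx
  rw [toReal_add_apply hf.1 hg.1 hxf hxg, add_apply]
  have h1 := (conj_le_coe_iff hf.1 u _).1 hcu.ge x hxf
  have h2 := (conj_le_coe_iff hg.1 v _).1 hcv.ge x hxg
  linarith

/-- A finite bound for the conjugate of a sum splits into bounds for the two conjugates. -/
theorem exists_conj_le_of_conj_add_le {f g : X → EReal}
    (hf : ∀ x, f x ≠ ⊥) (hg : ∀ x, g x ≠ ⊥) (hgc : IsConvexFun g) (hfp : IsPolyhedralFun f)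
    (hq : (effDom f ∩ qri (effDom g)).Nonempty) (x' : StrongDual ℝ X) (M : ℝ)
    (hM : conj (f + g) x' ≤ (M : EReal)) :
    ∃ (u : StrongDual ℝ X) (β : ℝ), conj f u ≤ (β : EReal) ∧
      conj g (x' - u) ≤ ((M - β : ℝ) : EReal) := by
  obtain ⟨x₀, hx₀f, hx₀g⟩ := hq
  obtain ⟨k, φ, α, hepi⟩ := hfp
  have hmem : ∀ x l, (∀ i ∈ Finset.univ, φ i (x, l) ≤ α i) ↔ f x ≤ (l : EReal) := fun x l => by
    have : (x, l) ∈ epi f ↔ ∀ i, φ i (x, l) ≤ α i := by rw [hepi]; rfl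
    simp only [Finset.mem_univ, true_imp_iff]
    exact this.symm
  rw [conj_le_coe_iff (add_apply_ne_bot hf hg)] at hM
  have hgr := hgc.convexOn_toReal hg
  have hconv : ConvexOn ℝ (effDom g ×ˢ (Set.univ : Set ℝ))
      (fun p : X × ℝ => (g p.1).toReal + (p.2 - x' p.1)) := by
    have hC := hgr.1.prod (convex_univ (𝕜 := ℝ) (E := ℝ))
    have h1 := (hgr.comp_linearMap (LinearMap.fst ℝ X ℝ)).subset (fun p hp => hp.1) hC
    exact h1.add (convexOn_strongDual hC
      (ContinuousLinearMap.snd ℝ X ℝ - x'.comp (ContinuousLinearMap.fst ℝ X ℝ)))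
  obtain ⟨b, β, hb, hbm⟩ := exists_multiplier φ α Finset.univ _ _ (-M) (x₀, (f x₀).toReal) hconv
    ((isDualQri_of_mem_qri hx₀g).prod_univ _)
    ((hmem _ _).2 (coe_toReal_of_mem_effDom hf hx₀f).ge) (by
      rintro ⟨x, l⟩ ⟨hxg, -⟩ hxl
      have hle := (hmem x l).1 hxl
      have hxf : x ∈ effDom f := hle.trans_lt (EReal.coe_lt_top _)
      have h1 := hM x ((mem_effDom_add hf hg).2 ⟨hxf, hxg⟩)
      rw [toReal_add_apply hf hg hxf hxg] at h1
      rw [← coe_toReal_of_mem_effDom hf hxf, EReal.coe_le_coe_iff] at hle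
      simp only
      linarith)
  set u : StrongDual ℝ X := b.comp (ContinuousLinearMap.inl ℝ X ℝ) with hu
  have hdec : ∀ x l, b (x, l) = u x + l * b (0, 1) := fun x l => by
    have : ((x, l) : X × ℝ) = (x, 0) + l • (0, 1) := by simp
    rw [this, map_add, map_smul, smul_eq_mul]
    simp [hu]
  have hlow : ∀ x ∈ effDom g, ∀ l : ℝ,
      -M ≤ (g x).toReal + (l - x' x) + (u x + l * b (0, 1) - β) := fun x hx l => by
    rw [← hdec]
    exact hbm (x, l) ⟨hx, trivial⟩
  -- For fixed `x` the bound is affine in `l` with slope `1 + b (0, 1)`.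
  have hslope : b (0, 1) = -1 := by
    by_contra hne
    have hne' : 1 + b (0, 1) ≠ 0 := fun h => hne (by linarith)
    set K := (g x₀).toReal - x' x₀ + u x₀ - β with hK
    have := hlow x₀ hx₀g.1 ((-M - 1 - K) / (1 + b (0, 1)))
    have hcancel : (-M - 1 - K) / (1 + b (0, 1)) * (1 + b (0, 1)) = -M - 1 - K :=
      div_mul_cancel₀ _ hne'
    nlinarith
  refine ⟨u, β, (conj_le_coe_iff hf u β).2 fun x hx => ?_,
    (conj_le_coe_iff hg _ _).2 fun x hx => ?_⟩
  · have := hb (x, (f x).toReal) ((hmem _ _).2 (coe_toReal_of_mem_effDom hf hx).ge)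
    rw [hdec, hslope] at this
    linarith
  · have := hlow x hx 0
    rw [sub_apply]
    linarith

/-- Attainment of the infimal convolution. -/
theorem exists_conj_add_eq {f g : X → EReal}
    (hf : IsProper f) (hg : IsProper g) (hgc : IsConvexFun g) (hfp : IsPolyhedralFun f)
    (hq : (effDom f ∩ qri (effDom g)).Nonempty) (x' : StrongDual ℝ X)
    (hfin : conj (f + g) x' < ⊤) :
    ∃ x₁ x₂ : StrongDual ℝ X, x' = x₁ + x₂ ∧ conj (f + g) x' = conj f x₁ + conj g x₂ := by
  have hprop : IsProper (f + g) := by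
    obtain ⟨x₀, hxf, hxg⟩ := hq
    exact ⟨add_apply_ne_bot hf.1 hg.1, x₀, (mem_effDom_add hf.1 hg.1).2 ⟨hxf, hxg.1⟩⟩
  have hcoe := EReal.coe_toReal hfin.ne (bot_lt_conj hprop x').ne'
  obtain ⟨u, β, hu, hv⟩ := exists_conj_le_of_conj_add_le hf.1 hg.1 hgc hfp hq x' _ hcoe.ge
  refine ⟨u, x' - u, by simp, le_antisymm ?_ ?_⟩
  · simpa using conj_add_le hf hg u (x' - u)
  · refine (add_le_add hu hv).trans ?_
    rw [← EReal.coe_add, add_sub_cancel, hcoe]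

end Conjugate

end PolyConvex

theorem theorem6p3 {X : Type*} [AddCommGroup X] [Module ℝ X] [TopologicalSpace X]
    [IsTopologicalAddGroup X] [ContinuousSMul ℝ X] [LocallyConvexSpace ℝ X]
    (f g : X → EReal)
    (hf : PolyConvex.IsProper f) (hfc : PolyConvex.IsConvexFun f)
    (hg : PolyConvex.IsProper g) (hgc : PolyConvex.IsConvexFun g)
    (hfp : PolyConvex.IsPolyhedralFun f)
    (hq : (PolyConvex.effDom f ∩ PolyConvex.qri (PolyConvex.effDom g)).Nonempty) :
    (∀ x' : StrongDual ℝ X,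
      PolyConvex.conj (f + g) x' =
        PolyConvex.infConv (PolyConvex.conj f) (PolyConvex.conj g) x') ∧
    (∀ x' : StrongDual ℝ X, PolyConvex.conj (f + g) x' < ⊤ →
      ∃ x₁ x₂ : StrongDual ℝ X, x' = x₁ + x₂ ∧
        PolyConvex.conj (f + g) x' = PolyConvex.conj f x₁ + PolyConvex.conj g x₂) := by
  have hattain := PolyConvex.exists_conj_add_eq hf hg hgc hfp hq
  refine ⟨fun x' => le_antisymm ?_ ?_, hattain⟩
  · refine le_iInf fun u => le_iInf fun v => le_iInf fun huv => ?_
    rw [← huv]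
    exact PolyConvex.conj_add_le hf hg u v
  · rcases eq_or_ne (PolyConvex.conj (f + g) x') ⊤ with htop | htop
    · rw [htop]
      exact le_top
    · obtain ⟨x₁, x₂, hx, heq⟩ := hattain x' htop.lt_top
      rw [heq]
      exact iInf_le_of_le x₁ (iInf_le_of_le x₂ (iInf_le_of_le hx.symm le_rfl))
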